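/- Let $X=\prod_{n\ge 1}\mathbb Z_2$ be the Cantor set, with $\mathbb Z_2=\{0,1\}$ and $x=(x(1),x(2),\dots)$ for $x\in X$. For $x\ne y$ in $X$ put $m(x,y)=\min\{n\ge 1: x(n)\ne y(n)\}$. For $\gamma\in(0,1)$ let $$\delta_\gamma(x,y)=\sum_{n=1}^\infty |x(n)-y(n)|\,\gamma^{n-1}(1-\gamma).$$ Let $\mu$ be the product on $X$ of the uniform probability measures on $\mathbb Z_2$, and let $C(X)=C(X,\mathbb C)$ act on $H=L^2(X,\mu)$ by multiplication. Let $s_n\in C(X)$ be $s_n(x)=2x(n)-1$, let $\mathcal A_n$ be the unital self-adjoint subalgebra of $C(X)$ generated by $s_1,\dots,s_n$ (so $\mathcal A_0=\mathbb C1$), let $P_n$ be the orthogonal projection of $H$ onto the finite-dimensional subspace $\mathcal A_n\subset H$, and let $Q_0=P_0$, $Q_n=P_n-P_{n-1}$ for $n\ge1$. Let $D_\gamma=\sum_{n=1}^\infty\gamma^{-n+1}Q_n$, an unbounded self-adjoint operator with domain the set of all $v\in H$ for which $\sum_n\gamma^{-n+1}Q_nv$ converges, and let $$d_\gamma(x,y)=\sup\{|a(x)-a(y)|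 : a\in C(X),\ \|[D_\gamma,a]\|\le 1\},$$ where $\|[D_\gamma,a]\|\le1$ means that the commutator, with domain $\{v\in\operatorname{dom}D_\gamma: av\in\operatorname{dom}D_\gamma\}$, is densely defined and extends to a bounded operator on $H$ of norm at most $1$. Two metrics $d,d'$ on $X$ are called equivalent if the identity map is bi-Lipschitz, i.e. there are constants $k,K>0$ with $k\,d(x,y)\le d'(x,y)\le K\,d(x,y)$ for all $x,y\in X$. Proposition. Let $\gamma\in(0,1)$. (i) For all $x\neq y$ in $X$: $\ \gamma^{m(x,y)-1}(1-\gamma)\le\delta_\gamma(x,y)\le\gamma^{m(x,y)-1}$. (ii) For all $x,y\in X$, $d_\gamma(x,y)$ is finite and $\ 2\delta_\gamma(x,y)\le d_\gamma(x,y)\le \dfrac{2}{(1-\gamma)^3}\,\delta_\gamma(x,y)$. (iii) If $\gamma_1\ne\gamma_2$ are in $(0,1)$, then $\delta_{\gamma_1}$ and $\delta_{\gamma_2}$ are not equivalent, and $d_{\gamma_1}$ and $d_{\gamma_2}$ are not equivalent. -/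

import Mathlib

open MeasureTheory
open scoped ENNReal NNReal

noncomputable section

/-- The Cantor set as the compact product group `Π ℤ₂`. The sequence `x(1), x(2), …` is indexed
from zero: the coordinate `x(n + 1)` is `x n`. -/
abbrev CantorGroup : Type := ℕ → ZMod 2

namespace CantorGroup

/-! ### The first differing coordinate and the metric `δ_γ` -/

/-- `m(x,y)`, the least `n ∈ {1, 2, 3, …}` such that the `n`-th coordinates of `x` and `y` differ
(meaningful for `x ≠ y`). -/
def m (x y : CantorGroup) : ℕ := sInf {n : ℕ | x n ≠ y n} + 1

/-- `δ_γ(x,y) = ∑_{n ≥ 1} |x(n) - y(n)| γ^(n-1) (1 - γ)`, where `ℤ₂ = {0, 1}`. -/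
def delta (γ : ℝ) (x y : CantorGroup) : ℝ :=
  ∑' n : ℕ, |((x n).val : ℝ) - ((y n).val : ℝ)| * γ ^ n * (1 - γ)

/-! ### The standard representation of `C(Π ℤ₂)` -/

/-- The measure giving each coordinate the uniform distribution on `ℤ₂`, independently. It is the
measure of the state `τ` with `τ(1) = 1` and `τ(e_{i₁} ⋯ e_{i_k}) = 2^{-k}` for distinct indices. -/
def mu : Measure CantorGroup :=
  Measure.infinitePi fun _ : ℕ => (PMF.uniformOfFintype (ZMod 2)).toMeasure

instance : IsProbabilityMeasure mu := by
  unfold mu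
  infer_instance

/-- The Hilbert space `L²(Π ℤ₂, μ)` of the GNS representation of `τ`. -/
abbrev H : Type := Lp ℂ 2 mu

/-- The map `η(a) = a ξ`, where the cyclic vector `ξ` is the constant function one. -/
def eta : C(CantorGroup, ℂ) →L[ℂ] H := ContinuousMap.toLp 2 mu ℂ

/-- The representation of `C(Π ℤ₂)` on `L²(Π ℤ₂, μ)` by multiplication. -/
def rep : C(CantorGroup, ℂ) →L[ℂ] (H →L[ℂ] H) :=
  ((ContinuousLinearMap.mul ℂ ℂ).holderL mu ∞ 2 2).comp (ContinuousMap.toLp ∞ mu ℂ)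

/-! ### The filtration and the Dirac operator -/

/-- The coordinate function `e_{k+1}`, with values in `{0, 1} ⊆ ℂ`. -/
def coord (k : ℕ) : C(CantorGroup, ℂ) where
  toFun x := ((x k).val : ℂ)
  continuous_toFun :=
    (continuous_of_discreteTopology (f := fun z : ZMod 2 => ((z.val : ℕ) : ℂ))).comp
      (continuous_apply k)

/-- The symmetry `s_{k+1} = 2 e_{k+1} - 1`. -/
def sym (k : ℕ) : C(CantorGroup, ℂ) := (2 : ℂ) • coord k - 1

/-- `𝒜_n`: the self-adjoint unital subalgebra generated by `s_1, …, s_n`. -/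
def alg (n : ℕ) : StarSubalgebra ℂ C(CantorGroup, ℂ) :=
  StarAlgebra.adjoin ℂ (sym '' Set.Iio n)

/-- `H_n = 𝒜_n ξ`. -/
def space (n : ℕ) : Submodule ℂ H :=
  (Subalgebra.toSubmodule (alg n).toSubalgebra).map (eta : C(CantorGroup, ℂ) →ₗ[ℂ] H)

lemma sym_mul_sym (k : ℕ) : sym k * sym k = 1 := by
  ext x
  simp only [sym, coord, ContinuousMap.mul_apply, ContinuousMap.sub_apply,
    ContinuousMap.smul_apply, ContinuousMap.coe_mk, ContinuousMap.one_apply]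
  have h : ∀ z : ZMod 2, z.val = 0 ∨ z.val = 1 := by decide
  rcases h (x k) with h | h <;> (simp [h]; try norm_num)

lemma star_sym (k : ℕ) : star (sym k) = sym k := by
  ext x
  simp [sym, coord, -ZMod.natCast_val]

instance (n : ℕ) : FiniteDimensional ℂ (space n) := by
  have h : Module.Finite ℂ (Subalgebra.toSubmodule (alg n).toSubalgebra) := by
    unfold alg
    rw [StarAlgebra.adjoin_toSubalgebra]
    refine Algebra.finite_adjoin_of_finite_of_isIntegral
      (((Set.finite_Iio n).image _).union ?_) ?_
    · have hs : star (sym '' Set.Iio n) = sym '' Set.Iio n := by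
        rw [← Set.image_star, Set.image_image]
        simp only [star_sym]
      rw [hs]
      exact (Set.finite_Iio n).image _
    · have hi : ∀ k, IsIntegral ℂ (sym k) := fun k =>
        IsIntegral.of_pow (n := 2) (by norm_num)
          (by rw [pow_two, sym_mul_sym]; exact isIntegral_one)
      rintro f (⟨k, -, rfl⟩ | ⟨k, -, hk⟩)
      · exact hi k
      · have hf : f = sym k := by rw [← star_sym k, hk, star_star]
        rw [hf]
        exact hi k
  unfold space
  infer_instance

/-- `P_n`, the orthogonal projection of `L²(Π ℤ₂, μ)` onto `H_n`. -/
def projP (n : ℕ) : H →L[ℂ] H := (space n).starProjection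

/-- `Q_0 = P_0` and `Q_n = P_n - P_{n-1}` for `n ≥ 1`. -/
def projQ : ℕ → (H →L[ℂ] H)
  | 0 => projP 0
  | n + 1 => projP (n + 1) - projP n

/-- The unbounded operator `∑ α_n Q_n`, with its maximal domain: all vectors `v` for which the
orthogonal series `∑ α_n Q_n v` converges. -/
def diagOp (α : ℕ → ℝ) : H →ₗ.[ℂ] H where
  domain :=
    { carrier := {v | Summable fun n => (α n : ℂ) • projQ n v}
      add_mem' := fun {v w} hv hw => by
        simpa only [Set.mem_ofPred_eq, map_add, smul_add] using Summable.add hv hw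
      zero_mem' := by
        simpa only [Set.mem_ofPred_eq, map_zero, smul_zero] using
          (summable_zero : Summable fun _ : ℕ => (0 : H))
      smul_mem' := fun c v hv => by
        simpa only [Set.mem_ofPred_eq, map_smul, smul_comm c] using Summable.const_smul c hv }
  toFun :=
    { toFun := fun v => ∑' n, (α n : ℂ) • projQ n (v : H)
      map_add' := fun v w => by
        simpa only [Submodule.coe_add, map_add, smul_add] using Summable.tsum_add v.2 w.2
      map_smul' := fun c v => by
        simpa only [Submodule.coe_smul, map_smul, smul_comm c, RingHom.id_apply] using
          Summable.tsum_const_smul c v.2 }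

/-- The eigenvalues `α_0 = 0` and `α_n = γ^(-n+1)` for `n ≥ 1`. -/
def eigenvalue (γ : ℝ) (n : ℕ) : ℝ := if n = 0 then 0 else γ ^ (-(n : ℤ) + 1)

/-- The Dirac operator `D_γ = ∑_{n ≥ 1} γ^(-n+1) Q_n`. -/
def dirac (γ : ℝ) : H →ₗ.[ℂ] H := diagOp (eigenvalue γ)

/-! ### The metric induced by a Dirac operator -/

/-- The natural domain of the commutator `[D, T] = D T - T D`: all `v ∈ dom D` with
`T v ∈ dom D`. -/
def commutatorDomain (D : H →ₗ.[ℂ] H) (T : H →L[ℂ] H) : Submodule ℂ H :=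
  D.domain ⊓ D.domain.comap (T : H →ₗ[ℂ] H)

/-- `‖[D, T]‖ ≤ c`: the commutator is densely defined and extends to a bounded operator on `H`
of norm at most `c`. -/
def CommutatorNormLE (D : H →ₗ.[ℂ] H) (T : H →L[ℂ] H) (c : ℝ) : Prop :=
  Dense (commutatorDomain D T : Set H) ∧
    ∃ B : H →L[ℂ] H, ‖B‖ ≤ c ∧
      ∀ (v : H) (hv : v ∈ D.domain) (hTv : T v ∈ D.domain),
        B v = D ⟨T v, hTv⟩ - T (D ⟨v, hv⟩)

/-- `sup {|φ(a) - ψ(a)| : a ∈ C(Π ℤ₂), ‖[D, a]‖ ≤ 1}` for functionals `φ`, `ψ` (in particular for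
states), as an extended nonnegative real. -/
def stateEDist (D : H →ₗ.[ℂ] H) (φ ψ : C(CantorGroup, ℂ) →L[ℂ] ℂ) : ℝ≥0∞ :=
  ⨆ (a : C(CantorGroup, ℂ)) (_ : CommutatorNormLE D (rep a) 1), ‖φ a - ψ a‖ₑ

/-- The value of `d_γ(x,y)` in `[0, ∞]`: the distance that `D_γ` induces between the pure states
`a ↦ a(x)` and `a ↦ a(y)`. -/
def diracEDist (γ : ℝ) (x y : CantorGroup) : ℝ≥0∞ :=
  stateEDist (dirac γ) (ContinuousMap.evalCLM ℂ x) (ContinuousMap.evalCLM ℂ y)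

/-- `d_γ(x,y)` as a real number. -/
def diracDist (γ : ℝ) (x y : CantorGroup) : ℝ := (diracEDist γ x y).toReal

end CantorGroup

/-! ### Bi-Lipschitz maps and equivalent metrics -/

/-- A bi-Lipschitz map between sets with distance functions `d` and `d'`. -/
def IsBiLipschitz {S T : Type*} (d : S → S → ℝ) (d' : T → T → ℝ) (F : S → T) : Prop :=
  Function.Bijective F ∧
    ∃ k K : ℝ, 0 < k ∧ 0 < K ∧
      ∀ x y : S, k * d x y ≤ d' (F x) (F y) ∧ d' (F x) (F y) ≤ K * d x y

/-- Two metrics on the same set are equivalent if the identity map is bi-Lipschitz. -/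
def EquivalentMetrics {S : Type*} (d d' : S → S → ℝ) : Prop := IsBiLipschitz d d' id

end

namespace CantorGroup

-- The projection `P_k` averages over cylinders of length `k`, so off the diagonal `∑ α_n Q_n` has
-- an integral kernel depending only on the index `N` of the first coordinate where two points
-- differ; for `D_γ` its modulus is at least `(2/γ)^N (1-γ)`.
--
-- Upper bound for `d_γ`: the matrix entry of `[D_γ, a]` between the indicators of the two halves of
-- a cylinder of length `N` is the kernel value times the difference of the integrals of `a` over
-- the halves, up to normalization (`abs_kernel_mul_norm_inner_cyl_sub_le`). If the commutator has
-- norm at most 1, the means of `a` around a point move by at most `γ^N/(1-γ)` from length `N` to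
-- `N+1`. Summing the geometric series bounds `|a(x) - a(y)|` by `2γ^N/(1-γ)^2` when `x`, `y` share
-- a cylinder of length `N`.
--
-- Lower bound: `γ^N • sym N` is an admissible test function (`commutatorNormLE_pow_smul_sym`),
-- because Abel summation turns its commutator into increments of the eigenvalues times commutators
-- with the `P_k`, and the increments telescope. It separates points first differing at `N` by
-- `2γ^N`, which is at least `2δ_γ`.
--
-- Inequivalence is tested on points differing in one coordinate, and passes from `δ_γ` to `d_γ` by
-- the two bounds.

local notation "⟪" u ", " v "⟫" => inner ℂ u v

/-! ### The multiplication representation -/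

lemma coeFn_eta (a : C(CantorGroup, ℂ)) : (eta a : CantorGroup → ℂ) =ᵐ[mu] a :=
  ContinuousMap.coeFn_toLp (p := 2) (𝕜 := ℂ) mu a

lemma rep_eta (a b : C(CantorGroup, ℂ)) : rep a (eta b) = eta (a * b) := by
  refine Lp.ext ?_
  have h1 : (rep a (eta b) : CantorGroup → ℂ) =ᵐ[mu] fun x =>
      ContinuousMap.toLp ∞ mu ℂ a x * eta b x :=
    ContinuousLinearMap.coeFn_holder (r := 2) (ContinuousLinearMap.mul ℂ ℂ)
      (ContinuousMap.toLp ∞ mu ℂ a) (eta b)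
  filter_upwards [h1, coeFn_eta b, coeFn_eta (a * b),
    ContinuousMap.coeFn_toLp (p := ∞) (𝕜 := ℂ) mu a] with x h1 h2 h3 h4
  rw [h1, h2, h3, h4]
  rfl

lemma denseRange_eta : DenseRange eta :=
  ContinuousMap.toLp_denseRange ℂ mu ℂ (by norm_num)

lemma inner_eta (a b : C(CantorGroup, ℂ)) :
    ⟪eta a, eta b⟫ = ∫ x, b x * (starRingEnd ℂ) (a x) ∂mu :=
  ContinuousMap.inner_toLp mu a b

lemma rep_mul_apply (a b : C(CantorGroup, ℂ)) (v : H) : rep (a * b) v = rep a (rep b v) := by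
  refine denseRange_eta.induction_on v (isClosed_eq (by fun_prop) (by fun_prop)) fun c => ?_
  simp only [rep_eta, mul_assoc]

lemma rep_one_apply (v : H) : rep 1 v = v := by
  refine denseRange_eta.induction_on v (isClosed_eq (by fun_prop) (by fun_prop)) fun c => ?_
  simp only [rep_eta, one_mul]

lemma rep_comm (a b : C(CantorGroup, ℂ)) (v : H) : rep a (rep b v) = rep b (rep a v) := by
  rw [← rep_mul_apply, mul_comm, rep_mul_apply]

lemma inner_rep_left (a : C(CantorGroup, ℂ)) (u v : H) :
    ⟪rep a u, v⟫ = ⟪u, rep (star a) v⟫ := by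
  refine denseRange_eta.induction_on₂ (p := fun u v => ⟪rep a u, v⟫ = ⟪u, rep (star a) v⟫)
    (isClosed_eq (by fun_prop) (by fun_prop)) (fun b c => ?_) u v
  simp only [rep_eta, inner_eta]
  congr 1 with x
  simp [mul_comm, mul_left_comm]

lemma norm_rep_apply_of_symmetry {s : C(CantorGroup, ℂ)} (hs : star s = s) (hss : s * s = 1)
    (v : H) : ‖rep s v‖ = ‖v‖ := by
  have h : ⟪rep s v, rep s v⟫ = ⟪v, v⟫ := by
    rw [inner_rep_left, hs, ← rep_mul_apply, hss, rep_one_apply]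
  rw [@norm_eq_sqrt_re_inner ℂ, @norm_eq_sqrt_re_inner ℂ H, h]

/-! ### The filtration -/

lemma eta_mem_space {n : ℕ} {a : C(CantorGroup, ℂ)} (ha : a ∈ alg n) : eta a ∈ space n :=
  ⟨a, ha, rfl⟩

lemma alg_mono {m n : ℕ} (h : m ≤ n) : alg m ≤ alg n :=
  StarAlgebra.adjoin_mono (Set.image_mono (Set.Iio_subset_Iio h))

lemma space_mono {m n : ℕ} (h : m ≤ n) : space m ≤ space n :=
  Submodule.map_mono (alg_mono h)

lemma sym_mem_alg {k n : ℕ} (h : k < n) : sym k ∈ alg n :=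
  StarAlgebra.subset_adjoin ℂ _ ⟨k, h, rfl⟩

lemma rep_mem_space {n : ℕ} {a : C(CantorGroup, ℂ)} (ha : a ∈ alg n) {v : H}
    (hv : v ∈ space n) : rep a v ∈ space n := by
  obtain ⟨b, hb, rfl⟩ := hv
  change rep a (eta b) ∈ _
  rw [rep_eta]
  exact eta_mem_space (mul_mem ha hb)

lemma projP_mem (n : ℕ) (v : H) : projP n v ∈ space n :=
  Submodule.starProjection_apply_mem _ _

lemma projP_eq_self {n : ℕ} {v : H} (hv : v ∈ space n) : projP n v = v :=
  Submodule.starProjection_eq_self_iff.2 hv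

lemma inner_projP {n : ℕ} {u : H} (hu : u ∈ space n) (v : H) : ⟪u, projP n v⟫ = ⟪u, v⟫ := by
  have h := Submodule.inner_starProjection_left_eq_right (space n) u v
  rw [show (space n).starProjection u = u from projP_eq_self hu] at h
  exact h.symm

/-- `H_n` is invariant under both `a` and `star a`, hence reduces `rep a`. -/
lemma projP_rep {k n : ℕ} (h : k ≤ n) {a : C(CantorGroup, ℂ)} (ha : a ∈ alg k) (v : H) :
    projP n (rep a v) = rep a (projP n v) := by
  have ha := alg_mono h ha
  refine Submodule.eq_starProjection_of_mem_of_inner_eq_zero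
    (rep_mem_space ha (projP_mem n v)) fun w hw => ?_
  rw [← map_sub, inner_rep_left, inner_sub_left, sub_eq_zero]
  have hw' := rep_mem_space (star_mem ha) hw
  rw [← inner_conj_symm, ← inner_conj_symm (projP n v), inner_projP hw']

/-- The inequality is strict because `Q_n` also involves `P_{n-1}`. -/
lemma projQ_rep {k n : ℕ} (h : k < n) {a : C(CantorGroup, ℂ)} (ha : a ∈ alg k) (v : H) :
    projQ n (rep a v) = rep a (projQ n v) := by
  obtain ⟨n, rfl⟩ : ∃ j, n = j + 1 := ⟨n - 1, by omega⟩
  simp only [projQ, sub_apply, map_sub]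
  rw [projP_rep (by omega) ha, projP_rep (by omega) ha]

lemma apply_eq_of_mem_alg {n : ℕ} {a : C(CantorGroup, ℂ)} (ha : a ∈ alg n)
    {x y : CantorGroup} (h : ∀ i < n, y i = x i) : a y = a x := by
  induction ha using StarAlgebra.adjoin_induction with
  | mem f hf =>
    obtain ⟨k, hk, rfl⟩ := hf
    simp [sym, coord, h k hk]
  | algebraMap r => simp
  | add f g _ _ hf hg => simp [hf, hg]
  | mul f g _ _ hf hg => simp [hf, hg]
  | star f _ hf => simp [hf]

/-- Stone–Weierstrass: the `sym k` separate points, and a polynomial in them uses only finitely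
many. -/
lemma exists_mem_alg_norm_sub_lt (a : C(CantorGroup, ℂ)) {ε : ℝ} (hε : 0 < ε) :
    ∃ n, ∃ b ∈ alg n, ‖a - b‖ < ε := by
  let A : StarSubalgebra ℂ C(CantorGroup, ℂ) := StarAlgebra.adjoin ℂ (Set.range sym)
  have hA : A.SeparatesPoints := by
    intro x y hxy
    obtain ⟨i, hi⟩ := Function.ne_iff.1 hxy
    refine ⟨sym i, ⟨sym i, StarAlgebra.subset_adjoin ℂ _ ⟨i, rfl⟩, rfl⟩, fun h => hi ?_⟩
    have : ((x i).val : ℂ) = (y i).val := by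
      simpa [sym, coord, -ZMod.natCast_val] using h
    exact ZMod.val_injective 2 (by exact_mod_cast this)
  have htop := ContinuousMap.starSubalgebra_topologicalClosure_eq_top_of_separatesPoints A hA
  have hmem : a ∈ closure (A : Set C(CantorGroup, ℂ)) := by
    rw [← StarSubalgebra.topologicalClosure_coe, htop]
    trivial
  obtain ⟨b, hb, hab⟩ := Metric.mem_closure_iff.1 hmem ε hε
  have hb' : ∃ n, b ∈ alg n := by
    clear hab
    change b ∈ StarAlgebra.adjoin ℂ (Set.range sym) at hb
    induction hb using StarAlgebra.adjoin_induction with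
    | mem f hf =>
      obtain ⟨k, rfl⟩ := hf
      exact ⟨k + 1, sym_mem_alg k.lt_succ_self⟩
    | algebraMap r => exact ⟨0, (alg 0).algebraMap_mem r⟩
    | add f g _ _ hf hg =>
      obtain ⟨i, hi⟩ := hf
      obtain ⟨j, hj⟩ := hg
      exact ⟨max i j, add_mem (alg_mono (le_max_left _ _) hi) (alg_mono (le_max_right _ _) hj)⟩
    | mul f g _ _ hf hg =>
      obtain ⟨i, hi⟩ := hf
      obtain ⟨j, hj⟩ := hg
      exact ⟨max i j, mul_mem (alg_mono (le_max_left _ _) hi) (alg_mono (le_max_right _ _) hj)⟩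
    | star f _ hf =>
      obtain ⟨i, hi⟩ := hf
      exact ⟨i, star_mem hi⟩
  obtain ⟨n, hn⟩ := hb'
  exact ⟨n, b, hn, by rwa [← dist_eq_norm]⟩

lemma dense_of_space_subset {s : Set H} (hs : ∀ n, (space n : Set H) ⊆ s) : Dense s := by
  have h : Dense (closure s) := by
    refine denseRange_eta.mono ?_
    rintro _ ⟨a, rfl⟩
    have ha : a ∈ closure {b | ∃ n, b ∈ alg n} := by
      refine Metric.mem_closure_iff.2 fun ε hε => ?_
      obtain ⟨n, b, hb, hab⟩ := exists_mem_alg_norm_sub_lt a hε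
      exact ⟨b, ⟨n, hb⟩, by rwa [dist_eq_norm]⟩
    refine map_mem_closure eta.continuous ha ?_
    rintro b ⟨n, hb⟩
    exact hs n (eta_mem_space hb)
  exact dense_closure.1 h

/-! ### Cylinder functions -/

/-- The indicator function of the set of all points that share their first `k` coordinates
with `x`. -/
noncomputable def cyl (k : ℕ) (x : CantorGroup) : C(CantorGroup, ℂ) :=
  ∏ i ∈ Finset.range k, ((2 : ℂ)⁻¹ • (1 + (2 * ((x i).val : ℂ) - 1) • sym i))

/-- Each factor is `(1 ± s)/2`, the projection of `s = sym i` for the sign that `s` takes at `x`. -/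
lemma cyl_apply (k : ℕ) (x y : CantorGroup) :
    cyl k x y = if ∀ i < k, y i = x i then 1 else 0 := by
  have hval : ∀ z : ZMod 2, z = 0 ∨ z = 1 := by decide
  have h : ∀ i, ((2 : ℂ)⁻¹ • (1 + (2 * ((x i).val : ℂ) - 1) • sym i)) y =
      if y i = x i then 1 else 0 := by
    intro i
    simp only [sym, coord, ContinuousMap.smul_apply, ContinuousMap.add_apply,
      ContinuousMap.one_apply, ContinuousMap.sub_apply, ContinuousMap.coe_mk, smul_eq_mul]
    rcases hval (x i) with h | h <;> rcases hval (y i) with h' | h' <;>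
      simp [h, h', ZMod.val_one] <;> norm_num
  rw [cyl, ContinuousMap.prod_apply, Finset.prod_congr rfl fun i _ => h i,
    Finset.prod_ite_zero]
  simp

lemma cyl_mem_alg (k : ℕ) (x : CantorGroup) : cyl k x ∈ alg k := by
  refine prod_mem fun i hi => ?_
  exact SMulMemClass.smul_mem _ (add_mem (one_mem _)
    (SMulMemClass.smul_mem _ (sym_mem_alg (Finset.mem_range.1 hi))))

lemma star_cyl (k : ℕ) (x : CantorGroup) : star (cyl k x) = cyl k x := by
  ext y
  simp only [ContinuousMap.star_apply, cyl_apply]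
  split_ifs <;> simp

lemma cyl_congr {k : ℕ} {x y : CantorGroup} (h : ∀ i < k, y i = x i) : cyl k y = cyl k x := by
  ext z
  simp only [cyl_apply]
  congr 1
  refine propext (forall₂_congr fun i hi => ?_)
  rw [h i hi]

lemma cyl_mul_of_mem_alg {k : ℕ} (x : CantorGroup) {a : C(CantorGroup, ℂ)} (ha : a ∈ alg k) :
    cyl k x * a = a x • cyl k x := by
  ext y
  simp only [ContinuousMap.mul_apply, ContinuousMap.smul_apply, cyl_apply, smul_eq_mul]
  split_ifs with h
  · rw [apply_eq_of_mem_alg ha h, one_mul, mul_one]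
  · simp

lemma integral_cyl (k : ℕ) (x : CantorGroup) : ∫ y, cyl k x y ∂mu = (2 : ℂ)⁻¹ ^ k := by
  let S : Set CantorGroup := Set.pi (Finset.range k) fun i => {x i}
  have hS : MeasurableSet S := MeasurableSet.pi (Finset.countable_toSet _) fun i _ => .of_discrete
  have h1 : (cyl k x : CantorGroup → ℂ) = S.indicator fun _ => 1 := by
    ext y
    have hm : y ∈ S ↔ ∀ i < k, y i = x i := by
      simp only [S, Set.mem_pi, Finset.mem_coe, Finset.mem_range, Set.mem_singleton_iff]
    rw [cyl_apply]
    split_ifs with h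
    · rw [Set.indicator_of_mem (hm.2 h)]
    · rw [Set.indicator_of_notMem (mt hm.1 h)]
  have h2 : mu S = 2⁻¹ ^ k := by
    rw [mu, Measure.infinitePi_pi _ fun i _ => .of_discrete]
    simp
  rw [h1, integral_indicator_const _ hS, measureReal_def, h2]
  simp

lemma norm_integral_mul_cyl_le (k : ℕ) (x : CantorGroup) (a : C(CantorGroup, ℂ)) :
    ‖∫ y, a y * cyl k x y ∂mu‖ ≤ ‖a‖ * 2⁻¹ ^ k := by
  have hn : ∀ y, ‖cyl k x y‖ = (cyl k x y).re := by
    intro y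
    rw [cyl_apply]
    split_ifs <;> simp
  have hc : Integrable (cyl k x) mu :=
    (cyl k x).continuous.integrable_of_hasCompactSupport (HasCompactSupport.of_compactSpace _)
  have hre : ∫ y, (cyl k x y).re ∂mu = 2⁻¹ ^ k := by
    have h := integral_re hc
    simp only [RCLike.re_to_complex] at h
    rw [h, integral_cyl, ← Complex.ofReal_ofNat, ← Complex.ofReal_inv, ← Complex.ofReal_pow,
      Complex.ofReal_re]
  rw [← hre, ← integral_const_mul]
  refine norm_integral_le_of_norm_le (hc.re.const_mul _) (.of_forall fun y => ?_)
  rw [norm_mul, hn]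
  exact mul_le_mul_of_nonneg_right (a.norm_coe_le_norm y) ((hn y) ▸ norm_nonneg _)

lemma inner_cyl_eta (k : ℕ) (x : CantorGroup) (a : C(CantorGroup, ℂ)) :
    ⟪eta (cyl k x), eta a⟫ = ∫ y, a y * cyl k x y ∂mu := by
  rw [inner_eta]
  congr 1 with y
  rw [show (starRingEnd ℂ) (cyl k x y) = star (cyl k x) y from rfl, star_cyl]

lemma cyl_mul_self (k : ℕ) (x : CantorGroup) : cyl k x * cyl k x = cyl k x := by
  ext y
  simp only [ContinuousMap.mul_apply, cyl_apply]
  split_ifs <;> simp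

lemma inner_cyl_one (k : ℕ) (x : CantorGroup) : ⟪eta (cyl k x), eta 1⟫ = (2 : ℂ)⁻¹ ^ k := by
  simp [inner_cyl_eta, integral_cyl]

lemma inner_cyl_self (k : ℕ) (x : CantorGroup) :
    ⟪eta (cyl k x), eta (cyl k x)⟫ = (2 : ℂ)⁻¹ ^ k := by
  rw [inner_cyl_eta, ← integral_cyl k x]
  congr 1 with y
  rw [← ContinuousMap.mul_apply, cyl_mul_self]

lemma norm_eta_cyl_sq (k : ℕ) (x : CantorGroup) : ‖eta (cyl k x)‖ ^ 2 = 2⁻¹ ^ k := by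
  have h := inner_self_eq_norm_sq_to_K (𝕜 := ℂ) (eta (cyl k x))
  rw [inner_cyl_self] at h
  apply Complex.ofReal_injective
  push_cast
  exact h.symm

/-- On a cylinder of length `k`, `P_k v` is the mean value of `v` over that cylinder. -/
lemma rep_cyl_projP (k : ℕ) (x : CantorGroup) (v : H) :
    rep (cyl k x) (projP k v) = (2 ^ k * ⟪eta (cyl k x), v⟫) • eta (cyl k x) := by
  obtain ⟨a, ha, hav⟩ := projP_mem k v
  change eta a = _ at hav
  rw [← inner_projP (eta_mem_space (cyl_mem_alg k x)) v, ← hav, rep_eta,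
    cyl_mul_of_mem_alg x ha, map_smul]
  have : ⟪eta (cyl k x), eta a⟫ = a x * (2 : ℂ)⁻¹ ^ k := by
    rw [← integral_cyl k x, inner_cyl_eta, ← integral_const_mul]
    congr 1 with y
    have := congrArg (fun f : C(CantorGroup, ℂ) => f y) (cyl_mul_of_mem_alg x ha)
    simpa [mul_comm] using this
  rw [this]
  congr 1
  rw [mul_left_comm, ← mul_pow]
  simp

/-! ### Means of Lipschitz functions over cylinders -/

lemma mem_domain_diagOp {α : ℕ → ℝ} {v : H} :
    v ∈ (diagOp α).domain ↔ Summable fun n => (α n : ℂ) • projQ n v := Iff.rfl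

lemma diagOp_apply {α : ℕ → ℝ} (v : H) (hv : v ∈ (diagOp α).domain) :
    diagOp α ⟨v, hv⟩ = ∑' n, (α n : ℂ) • projQ n v := rfl

/-- Summability depends only on the tail, where `Q_n` commutes with `p`. -/
lemma rep_mem_domain {α : ℕ → ℝ} {k : ℕ} {p : C(CantorGroup, ℂ)} (hp : p ∈ alg k) {v : H}
    (hv : v ∈ (diagOp α).domain) : rep p v ∈ (diagOp α).domain := by
  rw [mem_domain_diagOp] at hv ⊢
  rw [← summable_nat_add_iff (k + 1)] at hv ⊢
  convert hv.mapL (rep p) using 2 with n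
  rw [projQ_rep (by omega) hp, map_smul]

lemma cyl_mul_cyl {k n : ℕ} (h : k ≤ n) (x y : CantorGroup) :
    cyl n x * cyl k y = if ∀ i < k, x i = y i then cyl n x else 0 := by
  rw [cyl_mul_of_mem_alg x (alg_mono h (cyl_mem_alg k y)), cyl_apply]
  split_ifs <;> simp

/-- The value of the integral kernel of `∑ α_n Q_n` at pairs of points whose first differing
coordinate has index `N`. -/
noncomputable def kernel (α : ℕ → ℝ) (N : ℕ) : ℝ :=
  ∑ j ∈ Finset.range N, α (j + 1) * 2 ^ j - α (N + 1) * 2 ^ N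

/-- Both cylinders lie in one cylinder of length `k`, over which `P_k` takes the mean. -/
lemma rep_cyl_projP_rep_cyl {N k : ℕ} {x y : CantorGroup} (hxy : ∀ i < N, x i = y i)
    (hk : k ≤ N) (u : H) :
    rep (cyl (N + 1) y) (projP k (rep (cyl (N + 1) x) u)) =
      (2 ^ k * ⟪eta (cyl (N + 1) x), u⟫) • eta (cyl (N + 1) y) := by
  have hq : cyl (N + 1) y * cyl k y = cyl (N + 1) y := by
    rw [cyl_mul_cyl (by omega), if_pos fun _ _ => rfl]
  have hp : cyl (N + 1) x * cyl k y = cyl (N + 1) x := by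
    rw [cyl_mul_cyl (by omega), if_pos fun i hi => hxy i (by omega)]
  conv_lhs => rw [← hq]
  rw [rep_mul_apply, rep_cyl_projP, map_smul, rep_eta, hq]
  congr 2
  conv_lhs => rw [← star_cyl (N + 1) x]
  rw [← inner_rep_left, rep_eta, hp]

/-- The compression to two disjoint cylinders has rank one. For `j < N` the term of `Q_{j+1}`
contributes `2^(j+1) - 2^j = 2^j`; in `Q_{N+1}` only `-P_N` survives; later `Q_n` commute with the
cylinder functions, whose product is zero. -/
lemma rep_cyl_diagOp_rep_cyl {α : ℕ → ℝ} (h0 : α 0 = 0) {N : ℕ} {x y : CantorGroup}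
    (hxy : ∀ i < N, x i = y i) (hN : x N ≠ y N) {u : H}
    (hu : rep (cyl (N + 1) x) u ∈ (diagOp α).domain) :
    rep (cyl (N + 1) y) (diagOp α ⟨_, hu⟩) =
      (kernel α N * ⟪eta (cyl (N + 1) x), u⟫) • eta (cyl (N + 1) y) := by
  have hqp : cyl (N + 1) y * cyl (N + 1) x = 0 := by
    rw [cyl_mul_cyl le_rfl, if_neg fun h => hN (h N N.lt_succ_self).symm]
  have hfar : ∀ v, rep (cyl (N + 1) y) (rep (cyl (N + 1) x) v) = 0 := fun v => by
    rw [← rep_mul_apply, hqp, map_zero, zero_apply]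
  rw [diagOp_apply, (rep (cyl (N + 1) y)).map_tsum hu,
    tsum_eq_sum (s := Finset.range (N + 2)), Finset.sum_range_succ']
  · rw [h0, Complex.ofReal_zero, zero_smul, map_zero, add_zero, Finset.sum_range_succ]
    have hlt : ∀ j ∈ Finset.range N, rep (cyl (N + 1) y) ((α (j + 1) : ℂ) •
        projQ (j + 1) (rep (cyl (N + 1) x) u)) =
        ((α (j + 1) * 2 ^ j : ℝ) : ℂ) • ⟪eta (cyl (N + 1) x), u⟫ • eta (cyl (N + 1) y) := by
      intro j hj
      have hj := Finset.mem_range.1 hj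
      rw [map_smul, projQ, sub_apply, map_sub, rep_cyl_projP_rep_cyl hxy (by omega),
        rep_cyl_projP_rep_cyl hxy (by omega), ← sub_smul, smul_smul, smul_smul]
      congr 1
      push_cast
      ring
    rw [Finset.sum_congr rfl hlt, map_smul, projQ, sub_apply, map_sub,
      rep_cyl_projP_rep_cyl hxy le_rfl, projP_rep le_rfl (cyl_mem_alg _ _), hfar, zero_sub,
      ← Finset.sum_smul, smul_smul, smul_neg, smul_smul, ← sub_eq_add_neg, ← sub_smul, kernel]
    congr 1
    push_cast
    ring
  · intro n hn
    rw [Finset.mem_range] at hn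
    have hn : N + 1 < n := by omega
    rw [map_smul, projQ_rep hn (cyl_mem_alg _ _), hfar, smul_zero]

lemma rep_cyl_commutator_rep_cyl {α : ℕ → ℝ} (h0 : α 0 = 0) {a : C(CantorGroup, ℂ)}
    {B : H →L[ℂ] H}
    (hB : ∀ (v : H) (hv : v ∈ (diagOp α).domain) (hav : rep a v ∈ (diagOp α).domain),
      B v = diagOp α ⟨rep a v, hav⟩ - rep a (diagOp α ⟨v, hv⟩)) {N : ℕ}
    {x y : CantorGroup} (hxy : ∀ i < N, x i = y i) (hN : x N ≠ y N) {v : H}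
    (hv : v ∈ (diagOp α).domain) (hav : rep a v ∈ (diagOp α).domain) :
    rep (cyl (N + 1) y) (B (rep (cyl (N + 1) x) v)) =
      (kernel α N * ⟪eta (cyl (N + 1) x), rep a v⟫) • eta (cyl (N + 1) y) -
        (kernel α N * ⟪eta (cyl (N + 1) x), v⟫) • eta (a * cyl (N + 1) y) := by
  have hpv := rep_mem_domain (cyl_mem_alg (N + 1) x) hv
  have hpav := rep_mem_domain (cyl_mem_alg (N + 1) x) hav
  have hapv : rep a (rep (cyl (N + 1) x) v) ∈ (diagOp α).domain := by
    rw [rep_comm]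
    exact hpav
  have e : (⟨rep a (rep (cyl (N + 1) x) v), hapv⟩ : (diagOp α).domain) =
      ⟨rep (cyl (N + 1) x) (rep a v), hpav⟩ := Subtype.ext (rep_comm _ _ _)
  rw [hB _ hpv hapv, map_sub, e, rep_cyl_diagOp_rep_cyl h0 hxy hN, rep_comm _ a,
    rep_cyl_diagOp_rep_cyl h0 hxy hN, map_smul, rep_eta]

lemma abs_kernel_mul_norm_inner_cyl_sub_le {α : ℕ → ℝ} (h0 : α 0 = 0)
    {a : C(CantorGroup, ℂ)} (ha : CommutatorNormLE (diagOp α) (rep a) 1) {N : ℕ}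
    {x y : CantorGroup} (hxy : ∀ i < N, x i = y i) (hN : x N ≠ y N) :
    |kernel α N| * ‖⟪eta (cyl (N + 1) x), eta a⟫ - ⟪eta (cyl (N + 1) y), eta a⟫‖ ≤ 1 := by
  obtain ⟨hd, B, hB, hcomm⟩ := ha
  have key (v : H) : rep (cyl (N + 1) y) (B (rep (cyl (N + 1) x) v)) =
      (kernel α N * ⟪eta (cyl (N + 1) x), rep a v⟫) • eta (cyl (N + 1) y) -
        (kernel α N * ⟪eta (cyl (N + 1) x), v⟫) • eta (a * cyl (N + 1) y) := by
    have hcl : IsClosed {v : H | rep (cyl (N + 1) y) (B (rep (cyl (N + 1) x) v)) =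
      (kernel α N * ⟪eta (cyl (N + 1) x), rep a v⟫) • eta (cyl (N + 1) y) -
        (kernel α N * ⟪eta (cyl (N + 1) x), v⟫) • eta (a * cyl (N + 1) y)} :=
      isClosed_eq (by fun_prop) (by fun_prop)
    -- The identity must be extended by density before inserting `eta 1`, since `rep a (eta 1)` need
    -- not lie in the domain.
    exact hcl.closure_subset_iff.2
      (fun w hw => rep_cyl_commutator_rep_cyl h0 hcomm hxy hN hw.1 hw.2) (hd v)
  have hk := congrArg (fun w => ⟪eta (cyl (N + 1) y), w⟫) (key (eta 1))
  simp only [inner_sub_right, inner_smul_right, rep_eta, mul_one] at hk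
  have hqq : ⟪eta (cyl (N + 1) y), eta (a * cyl (N + 1) y)⟫ = ⟪eta (cyl (N + 1) y), eta a⟫ := by
    rw [mul_comm, ← rep_eta, ← star_cyl, ← inner_rep_left, rep_eta, star_cyl, cyl_mul_self]
  have hleft : ⟪eta (cyl (N + 1) y), rep (cyl (N + 1) y) (B (eta (cyl (N + 1) x)))⟫ = ⟪eta (cyl (N + 1) y), B (eta (cyl (N + 1) x))⟫ := by
    conv_lhs => rw [← star_cyl (N + 1) y]
    rw [← inner_rep_left, rep_eta, star_cyl, cyl_mul_self]
  rw [hqq, hleft, inner_cyl_one, inner_cyl_self] at hk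
  have hle : ‖⟪eta (cyl (N + 1) y), B (eta (cyl (N + 1) x))⟫‖ ≤ 2⁻¹ ^ (N + 1) := by
    calc ‖⟪eta (cyl (N + 1) y), B (eta (cyl (N + 1) x))⟫‖ ≤ ‖eta (cyl (N + 1) y)‖ * ‖B (eta (cyl (N + 1) x))‖ := norm_inner_le_norm _ _
      _ ≤ ‖eta (cyl (N + 1) y)‖ * ‖eta (cyl (N + 1) x)‖ := by
        gcongr
        simpa using B.le_of_opNorm_le hB (eta (cyl (N + 1) x))
      -- The two norms are equal, so passing to squares loses nothing and avoids square roots.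
      _ ≤ (‖eta (cyl (N + 1) y)‖ ^ 2 + ‖eta (cyl (N + 1) x)‖ ^ 2) / 2 := by nlinarith [sq_nonneg (‖eta (cyl (N + 1) y)‖ - ‖eta (cyl (N + 1) x)‖)]
      _ = 2⁻¹ ^ (N + 1) := by rw [norm_eta_cyl_sq, norm_eta_cyl_sq]; ring
  have hk' : ⟪eta (cyl (N + 1) y), B (eta (cyl (N + 1) x))⟫ =
      (kernel α N : ℂ) * (⟪eta (cyl (N + 1) x), eta a⟫ - ⟪eta (cyl (N + 1) y), eta a⟫) * 2⁻¹ ^ (N + 1) := by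
    rw [hk]; ring
  rw [hk', norm_mul, norm_mul, Complex.norm_real, norm_pow, norm_inv, Complex.norm_ofNat,
    Real.norm_eq_abs] at hle
  exact le_of_mul_le_mul_right (by rwa [one_mul]) (by positivity : (0 : ℝ) < 2⁻¹ ^ (N + 1))

/-- The mean value of `a` over the cylinder of length `k` around `x`. -/
noncomputable def mean (k : ℕ) (x : CantorGroup) (a : C(CantorGroup, ℂ)) : ℂ :=
  2 ^ k * ⟪eta (cyl k x), eta a⟫

lemma mean_sub (k : ℕ) (x : CantorGroup) (a b : C(CantorGroup, ℂ)) :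
    mean k x (a - b) = mean k x a - mean k x b := by
  simp [mean, inner_sub_right, mul_sub]

lemma norm_mean_le (k : ℕ) (x : CantorGroup) (a : C(CantorGroup, ℂ)) :
    ‖mean k x a‖ ≤ ‖a‖ := by
  rw [mean, inner_cyl_eta, norm_mul, norm_pow, Complex.norm_ofNat]
  calc (2 : ℝ) ^ k * _ ≤ 2 ^ k * (‖a‖ * 2⁻¹ ^ k) := by
        gcongr
        exact norm_integral_mul_cyl_le k x a
    _ = ‖a‖ := by rw [mul_left_comm, ← mul_pow]; simp

lemma mean_of_mem_alg {k : ℕ} (x : CantorGroup) {a : C(CantorGroup, ℂ)} (ha : a ∈ alg k) :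
    mean k x a = a x := by
  rw [mean, ← cyl_mul_self, ← rep_eta, inner_rep_left, star_cyl, rep_eta,
    cyl_mul_of_mem_alg x ha, map_smul, inner_smul_right, inner_cyl_self, mul_left_comm, ← mul_pow]
  simp

lemma mean_congr {k : ℕ} {x y : CantorGroup} (h : ∀ i < k, y i = x i) (a : C(CantorGroup, ℂ)) :
    mean k y a = mean k x a := by
  rw [mean, mean, cyl_congr h]

/-- On `alg n` the mean is exact once `k ≥ n`; a uniform approximation handles general `a`. -/
lemma tendsto_mean (x : CantorGroup) (a : C(CantorGroup, ℂ)) :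
    Filter.Tendsto (fun k => mean k x a) Filter.atTop (nhds (a x)) := by
  refine Metric.tendsto_atTop.2 fun ε hε => ?_
  obtain ⟨n, b, hb, hab⟩ := exists_mem_alg_norm_sub_lt a (half_pos hε)
  refine ⟨n, fun k hk => ?_⟩
  have h : mean k x a - a x = mean k x (a - b) - (a - b) x := by
    rw [mean_sub, mean_of_mem_alg x (alg_mono hk hb), ContinuousMap.sub_apply]
    ring
  rw [dist_eq_norm, h]
  have h1 := norm_mean_le k x (a - b)
  have h2 := (a - b).norm_coe_le_norm x
  have h3 := norm_sub_le (mean k x (a - b)) ((a - b) x)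
  linarith

lemma exists_mean_succ_sub_eq (N : ℕ) (x : CantorGroup) (a : C(CantorGroup, ℂ)) :
    ∃ y : CantorGroup, (∀ i < N, x i = y i) ∧ x N ≠ y N ∧
      mean (N + 1) x a - mean N x a =
        2 ^ N * (⟪eta (cyl (N + 1) x), eta a⟫ - ⟪eta (cyl (N + 1) y), eta a⟫) := by
  -- Flipping coordinate `N` gives the sibling half, and `2^(N+1) p - 2^N (p + q) = 2^N (p - q)`.
  refine ⟨Function.update x N (x N + 1), fun i hi => ?_, ?_, ?_⟩
  · rw [Function.update_of_ne hi.ne]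
  · simp
  · have h : cyl N x = cyl (N + 1) x + cyl (N + 1) (Function.update x N (x N + 1)) := by
      ext z
      have hz : ∀ s t : ZMod 2, s = t + 1 ↔ ¬ s = t := by decide
      have hu : (∀ i < N, z i = Function.update x N (x N + 1) i) ↔ ∀ i < N, z i = x i :=
        forall₂_congr fun i hi => by rw [Function.update_of_ne hi.ne]
      simp only [ContinuousMap.add_apply, cyl_apply, Nat.forall_lt_succ_right, hu,
        Function.update_self, hz]
      by_cases h1 : ∀ i < N, z i = x i <;> by_cases h2 : z N = x N <;> simp [h1, h2]
    rw [mean, mean, h, map_add, inner_add_left]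
    ring

/-! ### The upper estimate for `d_γ` -/

lemma eigenvalue_zero (γ : ℝ) : eigenvalue γ 0 = 0 := by simp [eigenvalue]

lemma eigenvalue_succ (γ : ℝ) (n : ℕ) : eigenvalue γ (n + 1) = (γ ^ n)⁻¹ := by
  rw [eigenvalue, if_neg n.succ_ne_zero, ← zpow_natCast, ← zpow_neg]
  congr 1
  push_cast
  ring

/-- The last, negative term dominates: the preceding geometric sum is at most `γ` times its size. -/
lemma le_abs_kernel_eigenvalue {γ : ℝ} (hγ : γ ∈ Set.Ioo (0 : ℝ) 1) (N : ℕ) :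
    (2 / γ) ^ N * (1 - γ) ≤ |kernel (eigenvalue γ) N| := by
  obtain ⟨h0, h1⟩ := hγ
  have hs : ∑ j ∈ Finset.range N, (2 / γ) ^ j ≤ γ * (2 / γ) ^ N := by
    induction N with
    | zero => simpa using h0.le
    | succ N ih =>
      have e : γ * (2 / γ) ^ (N + 1) = 2 * (2 / γ) ^ N := by
        rw [pow_succ]
        field_simp
      have hp : 0 < (2 / γ) ^ N := by positivity
      rw [Finset.sum_range_succ, e]
      nlinarith [ih]
  have hk : kernel (eigenvalue γ) N = ∑ j ∈ Finset.range N, (2 / γ) ^ j - (2 / γ) ^ N := by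
    simp only [kernel, eigenvalue_succ, div_eq_inv_mul, mul_pow, inv_pow]
  rw [hk]
  refine le_trans ?_ (neg_le_abs _)
  linarith

lemma norm_mean_succ_sub_le {γ : ℝ} (hγ : γ ∈ Set.Ioo (0 : ℝ) 1) {a : C(CantorGroup, ℂ)}
    (ha : CommutatorNormLE (dirac γ) (rep a) 1) (N : ℕ) (x : CantorGroup) :
    ‖mean (N + 1) x a - mean N x a‖ ≤ γ ^ N / (1 - γ) := by
  obtain ⟨y, hxy, hN, h⟩ := exists_mean_succ_sub_eq N x a
  have h1 := abs_kernel_mul_norm_inner_cyl_sub_le (eigenvalue_zero γ) ha hxy hN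
  have h2 := le_abs_kernel_eigenvalue hγ N
  obtain ⟨h0, hlt⟩ := hγ
  have h3 := (mul_le_mul_of_nonneg_right h2 (norm_nonneg _)).trans h1
  rw [h, norm_mul, norm_pow, Complex.norm_ofNat, le_div_iff₀ (by linarith)]
  rw [div_pow, div_mul_eq_mul_div, div_mul_eq_mul_div, div_le_one (by positivity)] at h3
  linarith

lemma norm_apply_sub_mean_le {γ : ℝ} (hγ : γ ∈ Set.Ioo (0 : ℝ) 1) {a : C(CantorGroup, ℂ)}
    (ha : CommutatorNormLE (dirac γ) (rep a) 1) (N : ℕ) (x : CantorGroup) :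
    ‖a x - mean N x a‖ ≤ γ ^ N / (1 - γ) ^ 2 := by
  have h1 : 0 < 1 - γ := by linarith [hγ.2]
  -- The bound is the exact partial sum of the geometric series, so the induction closes.
  have key : ∀ j, ‖mean (N + j) x a - mean N x a‖ ≤ (γ ^ N - γ ^ (N + j)) / (1 - γ) ^ 2 := by
    intro j
    induction j with
    | zero => simp
    | succ j ih =>
      have h2 := norm_mean_succ_sub_le hγ ha (N + j) x
      have h3 := norm_add_le (mean (N + j + 1) x a - mean (N + j) x a)
        (mean (N + j) x a - mean N x a)
      rw [sub_add_sub_cancel] at h3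
      refine h3.trans ((add_le_add h2 ih).trans_eq ?_)
      rw [← add_assoc, pow_succ γ (N + j)]
      field_simp
      ring
  refine le_of_tendsto ((tendsto_mean x a).sub_const _).norm ?_
  filter_upwards [Filter.eventually_ge_atTop N] with k hk
  obtain ⟨j, rfl⟩ := Nat.exists_eq_add_of_le hk
  refine (key j).trans ?_
  gcongr
  linarith [pow_pos hγ.1 (N + j)]

lemma norm_apply_sub_apply_le {γ : ℝ} (hγ : γ ∈ Set.Ioo (0 : ℝ) 1) {a : C(CantorGroup, ℂ)}
    (ha : CommutatorNormLE (dirac γ) (rep a) 1) {N : ℕ} {x y : CantorGroup}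
    (hxy : ∀ i < N, x i = y i) : ‖a x - a y‖ ≤ 2 * γ ^ N / (1 - γ) ^ 2 := by
  have hx := norm_apply_sub_mean_le hγ ha N x
  have hy := norm_apply_sub_mean_le hγ ha N y
  rw [← mean_congr hxy] at hy
  have h := norm_sub_le (a x - mean N x a) (a y - mean N x a)
  rw [sub_sub_sub_cancel_right] at h
  calc _ ≤ _ := h
    _ ≤ _ := add_le_add hx hy
    _ = _ := by ring

/-! ### Commutators with elements of the filtration -/

/-- Abel summation; the last term is the boundary term, which vanishes when `P_n` commutes with `rep
a`. -/
lemma sum_smul_projQ_commutator (α : ℕ → ℝ) (a : C(CantorGroup, ℂ)) (v : H) (n : ℕ) :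
    ∑ k ∈ Finset.range (n + 1), (α k : ℂ) • (projQ k (rep a v) - rep a (projQ k v)) =
      ∑ k ∈ Finset.range n, ((α (k + 1) - α k : ℝ) : ℂ) • (rep a (projP k v) - projP k (rep a v)) -
        (α n : ℂ) • (rep a (projP n v) - projP n (rep a v)) := by
  induction n with
  | zero =>
    simp only [zero_add, Finset.sum_range_one, Finset.range_zero, Finset.sum_empty, projQ]
    module
  | succ n ih =>
    rw [Finset.sum_range_succ, ih, Finset.sum_range_succ _ n]
    simp only [projQ, sub_apply, map_sub]
    push_cast
    module

lemma diagOp_commutator_apply {α : ℕ → ℝ} {n : ℕ} {a : C(CantorGroup, ℂ)} (ha : a ∈ alg n)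
    {v : H} (hv : v ∈ (diagOp α).domain) (hav : rep a v ∈ (diagOp α).domain) :
    diagOp α ⟨rep a v, hav⟩ - rep a (diagOp α ⟨v, hv⟩) =
      ∑ k ∈ Finset.range n,
        ((α (k + 1) - α k : ℝ) : ℂ) • (rep a (projP k v) - projP k (rep a v)) := by
  have hs := sum_smul_projQ_commutator α a v n
  rw [projP_rep le_rfl ha, sub_self, smul_zero, sub_zero] at hs
  rw [← hs, diagOp_apply, diagOp_apply, (rep a).map_tsum hv,
    ← Summable.tsum_sub hav (ContinuousLinearMap.summable (rep a) hv),
    tsum_eq_sum (s := Finset.range (n + 1))]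
  · refine Finset.sum_congr rfl fun k _ => ?_
    rw [map_smul, smul_sub]
  · intro k hk
    rw [Finset.mem_range] at hk
    rw [map_smul, projQ_rep (by omega) ha, sub_self]

lemma space_subset_domain (α : ℕ → ℝ) (n : ℕ) : (space n : Set H) ⊆ (diagOp α).domain := by
  intro v hv
  refine summable_of_ne_finset_zero (s := Finset.range (n + 1)) fun k hk => ?_
  rw [Finset.mem_range] at hk
  obtain ⟨j, rfl⟩ : ∃ j, k = j + 1 := ⟨k - 1, by omega⟩
  rw [projQ, sub_apply, projP_eq_self (space_mono (by omega) hv),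
    projP_eq_self (space_mono (by omega) hv), sub_self, smul_zero]

lemma norm_sub_two_smul_projP (n : ℕ) (v : H) : ‖v - (2 : ℂ) • projP n v‖ = ‖v‖ := by
  have h := (space n).reflection.norm_map v
  rw [Submodule.reflection_apply] at h
  rw [← h, ← norm_neg]
  congr 1
  rw [neg_sub, two_smul, two_smul]
  rfl

/-- `‖[P_n, s]‖ ≤ 1` for a symmetry `s`. -/
lemma norm_rep_projP_sub_le {s : C(CantorGroup, ℂ)} (hs : star s = s) (hss : s * s = 1)
    (n : ℕ) (v : H) : ‖rep s (projP n v) - projP n (rep s v)‖ ≤ ‖v‖ := by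
  -- Twice the commutator is a commutator of two isometries, `1 - 2P_n` and `rep s`.
  have h : (2 : ℂ) • (rep s (projP n v) - projP n (rep s v)) =
      (rep s v - (2 : ℂ) • projP n (rep s v)) - rep s (v - (2 : ℂ) • projP n v) := by
    rw [map_sub, map_smul]
    module
  have h2 := congrArg norm h
  rw [norm_smul, Complex.norm_ofNat] at h2
  have h3 := norm_sub_le (rep s v - (2 : ℂ) • projP n (rep s v))
    (rep s (v - (2 : ℂ) • projP n v))
  rw [norm_sub_two_smul_projP, norm_rep_apply_of_symmetry hs hss,
    norm_rep_apply_of_symmetry hs hss, norm_sub_two_smul_projP] at h3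
  linarith

lemma norm_rep_comp_projP_sub_le {s : C(CantorGroup, ℂ)} (hs : star s = s) (hss : s * s = 1)
    {c : ℝ} (hc : 0 ≤ c) (n : ℕ) :
    ‖rep ((c : ℂ) • s) ∘L projP n - projP n ∘L rep ((c : ℂ) • s)‖ ≤ c := by
  refine ContinuousLinearMap.opNorm_le_bound _ hc fun v => ?_
  have e : (rep ((c : ℂ) • s) ∘L projP n - projP n ∘L rep ((c : ℂ) • s)) v =
      (c : ℂ) • (rep s (projP n v) - projP n (rep s v)) := by
    rw [map_smul, smul_sub, sub_apply, ContinuousLinearMap.comp_apply,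
      ContinuousLinearMap.comp_apply, smul_apply, smul_apply, map_smul]
  rw [e, norm_smul, Complex.norm_real, Real.norm_of_nonneg hc]
  exact mul_le_mul_of_nonneg_left (norm_rep_projP_sub_le hs hss n v) hc

lemma norm_sum_smul_le_of_monotone {E : Type*} [NormedAddCommGroup E] [NormedSpace ℂ E]
    {α : ℕ → ℝ} (hα : Monotone α) (h0 : α 0 = 0) {T : ℕ → E} {c : ℝ} (hT : ∀ k, ‖T k‖ ≤ c)
    (n : ℕ) : ‖∑ k ∈ Finset.range n, ((α (k + 1) - α k : ℝ) : ℂ) • T k‖ ≤ c * α n := by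
  have hsum : c * α n = ∑ k ∈ Finset.range n, (α (k + 1) - α k) * c := by
    rw [← Finset.sum_mul, Finset.sum_range_sub, h0, sub_zero, mul_comm]
  rw [hsum]
  refine norm_sum_le_of_le _ fun k _ => ?_
  have hd : 0 ≤ α (k + 1) - α k := sub_nonneg.2 (hα k.le_succ)
  rw [norm_smul, Complex.norm_real, Real.norm_of_nonneg hd]
  exact mul_le_mul_of_nonneg_left (hT k) hd

lemma mem_commutatorDomain {D : H →ₗ.[ℂ] H} {T : H →L[ℂ] H} {v : H} :
    v ∈ commutatorDomain D T ↔ v ∈ D.domain ∧ T v ∈ D.domain := Iff.rfl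

lemma commutatorNormLE_smul {α : ℕ → ℝ} (hα : Monotone α) (h0 : α 0 = 0)
    {s : C(CantorGroup, ℂ)} (hs : star s = s) (hss : s * s = 1) {n : ℕ} (hn : s ∈ alg n) {c : ℝ}
    (hc : 0 ≤ c) : CommutatorNormLE (diagOp α) (rep ((c : ℂ) • s)) (c * α n) := by
  have hcs : (c : ℂ) • s ∈ alg n := SMulMemClass.smul_mem _ hn
  refine ⟨dense_of_space_subset fun k v hv => ?_, ∑ k ∈ Finset.range n,
    ((α (k + 1) - α k : ℝ) : ℂ) •
      (rep ((c : ℂ) • s) ∘L projP k - projP k ∘L rep ((c : ℂ) • s)),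
    norm_sum_smul_le_of_monotone hα h0 (norm_rep_comp_projP_sub_le hs hss hc) n, ?_⟩
  · exact mem_commutatorDomain.2 ⟨space_subset_domain α k hv,
      rep_mem_domain hcs (space_subset_domain α k hv)⟩
  · intro v hv hav
    rw [diagOp_commutator_apply hcs hv hav, sum_apply]
    rfl

lemma eigenvalue_monotone {γ : ℝ} (hγ : γ ∈ Set.Ioo (0 : ℝ) 1) : Monotone (eigenvalue γ) := by
  refine monotone_nat_of_le_succ fun n => ?_
  have h0 := hγ.1
  rw [eigenvalue_succ]
  cases n with
  | zero =>
    rw [eigenvalue_zero]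
    positivity
  | succ n =>
    rw [eigenvalue_succ]
    exact inv_anti₀ (by positivity) (pow_le_pow_of_le_one h0.le hγ.2.le n.le_succ)

/-- The factor `γ^N` exactly cancels the eigenvalue `γ^(-N)` of `Q_{N+1}`. -/
lemma commutatorNormLE_pow_smul_sym {γ : ℝ} (hγ : γ ∈ Set.Ioo (0 : ℝ) 1) (N : ℕ) :
    CommutatorNormLE (dirac γ) (rep (((γ ^ N : ℝ) : ℂ) • sym N)) 1 := by
  have h := commutatorNormLE_smul (eigenvalue_monotone hγ) (eigenvalue_zero γ) (star_sym N)
    (sym_mul_sym N) (sym_mem_alg N.lt_succ_self) (pow_nonneg hγ.1.le N)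
  rwa [eigenvalue_succ, mul_inv_cancel₀ (pow_pos hγ.1 N).ne'] at h

/-! ### The first differing coordinate and `δ_γ` -/

lemma apply_eq_of_lt_m {x y : CantorGroup} {i : ℕ} (hi : i < m x y - 1) : x i = y i := by
  simp only [m, Nat.add_sub_cancel] at hi
  simpa using Nat.notMem_of_lt_sInf hi

lemma apply_m_ne {x y : CantorGroup} (h : x ≠ y) : x (m x y - 1) ≠ y (m x y - 1) :=
  Nat.sInf_mem (s := {n | x n ≠ y n}) (Function.ne_iff.1 h)

lemma abs_val_sub_val (s t : ZMod 2) :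
    |(s.val : ℝ) - (t.val : ℝ)| = if s = t then 0 else 1 := by
  have hval : ∀ z : ZMod 2, z = 0 ∨ z = 1 := by decide
  rcases hval s with rfl | rfl <;> rcases hval t with rfl | rfl <;> simp [ZMod.val_one]

lemma delta_eq (γ : ℝ) (x y : CantorGroup) :
    delta γ x y = ∑' n, if x n = y n then 0 else γ ^ n * (1 - γ) := by
  simp only [delta, abs_val_sub_val, ite_mul, zero_mul, one_mul]

lemma delta_self (γ : ℝ) (x : CantorGroup) : delta γ x x = 0 := by simp [delta]

lemma delta_term_nonneg {γ : ℝ} (hγ : γ ∈ Set.Ioo (0 : ℝ) 1) (x y : CantorGroup) (n : ℕ) :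
    0 ≤ if x n = y n then 0 else γ ^ n * (1 - γ) := by
  split_ifs
  · rfl
  · exact mul_nonneg (pow_nonneg hγ.1.le n) (by linarith [hγ.2])

lemma delta_term_le {γ : ℝ} (hγ : γ ∈ Set.Ioo (0 : ℝ) 1) (x y : CantorGroup) (n : ℕ) :
    (if x n = y n then 0 else γ ^ n * (1 - γ)) ≤ γ ^ n * (1 - γ) := by
  split_ifs
  · exact mul_nonneg (pow_nonneg hγ.1.le n) (by linarith [hγ.2])
  · rfl

lemma summable_delta {γ : ℝ} (hγ : γ ∈ Set.Ioo (0 : ℝ) 1) (x y : CantorGroup) :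
    Summable fun n => if x n = y n then 0 else γ ^ n * (1 - γ) :=
  .of_nonneg_of_le (delta_term_nonneg hγ x y) (delta_term_le hγ x y)
    ((summable_geometric_of_lt_one hγ.1.le hγ.2).mul_right _)

lemma le_delta {γ : ℝ} (hγ : γ ∈ Set.Ioo (0 : ℝ) 1) {x y : CantorGroup} (h : x ≠ y) :
    γ ^ (m x y - 1) * (1 - γ) ≤ delta γ x y := by
  have hle := (summable_delta hγ x y).le_tsum (m x y - 1) fun n _ => delta_term_nonneg hγ x y n
  rwa [if_neg (apply_m_ne h), ← delta_eq] at hle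

/-- The terms before the first difference vanish and the rest is below a geometric tail. For `x = y`
the infimum of the empty set makes `m x y - 1 = 0`, and the bound is 1. -/
lemma delta_le {γ : ℝ} (hγ : γ ∈ Set.Ioo (0 : ℝ) 1) (x y : CantorGroup) :
    delta γ x y ≤ γ ^ (m x y - 1) := by
  have hs := summable_delta hγ x y
  have h1 : 1 - γ ≠ 0 := by linarith [hγ.2]
  have hg : HasSum (fun n => γ ^ (n + (m x y - 1)) * (1 - γ)) (γ ^ (m x y - 1)) := by
    have h := (hasSum_geometric_of_lt_one hγ.1.le hγ.2).mul_right (γ ^ (m x y - 1) * (1 - γ))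
    rw [mul_comm _ (1 - γ), inv_mul_cancel_left₀ h1] at h
    refine h.congr_fun fun n => ?_
    rw [pow_add]
    ring
  have htail : ∑' n, (if x (n + (m x y - 1)) = y (n + (m x y - 1)) then 0
      else γ ^ (n + (m x y - 1)) * (1 - γ)) ≤ γ ^ (m x y - 1) :=
    hasSum_le (fun n => delta_term_le hγ x y _)
      ((summable_nat_add_iff (m x y - 1)).2 hs).hasSum hg
  rw [delta_eq, ← hs.sum_add_tsum_nat_add (m x y - 1), Finset.sum_eq_zero, zero_add]
  · exact htail
  · intro i hi
    rw [if_pos (apply_eq_of_lt_m (Finset.mem_range.1 hi))]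

/-! ### Comparison of `d_γ` and `δ_γ` -/

lemma diracEDist_self (γ : ℝ) (x : CantorGroup) : diracEDist γ x x = 0 := by
  simp [diracEDist, stateEDist]

lemma diracEDist_le {γ : ℝ} (hγ : γ ∈ Set.Ioo (0 : ℝ) 1) (x y : CantorGroup) :
    diracEDist γ x y ≤ ENNReal.ofReal (2 / (1 - γ) ^ 3 * delta γ x y) := by
  obtain rfl | hxy := eq_or_ne x y
  · rw [diracEDist_self]
    exact zero_le
  have h1 : 0 < 1 - γ := by linarith [hγ.2]
  refine iSup₂_le fun a ha => ?_
  rw [← ofReal_norm]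
  refine ENNReal.ofReal_le_ofReal ?_
  calc ‖a x - a y‖ ≤ 2 * γ ^ (m x y - 1) / (1 - γ) ^ 2 :=
        norm_apply_sub_apply_le hγ ha fun i hi => apply_eq_of_lt_m hi
    -- The third factor `1 - γ` comes from the lower bound for `delta`.
    _ = 2 / (1 - γ) ^ 3 * (γ ^ (m x y - 1) * (1 - γ)) := by field_simp
    _ ≤ _ := by
      gcongr
      exact le_delta hγ hxy

lemma diracEDist_ne_top {γ : ℝ} (hγ : γ ∈ Set.Ioo (0 : ℝ) 1) (x y : CantorGroup) :
    diracEDist γ x y ≠ ⊤ :=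
  ((diracEDist_le hγ x y).trans_lt ENNReal.ofReal_lt_top).ne

lemma delta_nonneg {γ : ℝ} (hγ : γ ∈ Set.Ioo (0 : ℝ) 1) (x y : CantorGroup) :
    0 ≤ delta γ x y :=
  delta_eq γ x y ▸ tsum_nonneg (delta_term_nonneg hγ x y)

lemma diracDist_le {γ : ℝ} (hγ : γ ∈ Set.Ioo (0 : ℝ) 1) (x y : CantorGroup) :
    diracDist γ x y ≤ 2 / (1 - γ) ^ 3 * delta γ x y := by
  have h1 : 0 < 1 - γ := by linarith [hγ.2]
  exact ENNReal.toReal_le_of_le_ofReal (mul_nonneg (by positivity) (delta_nonneg hγ x y))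
    (diracEDist_le hγ x y)

lemma norm_sym_apply_sub_apply {x y : CantorGroup} {N : ℕ} (h : x N ≠ y N) :
    ‖sym N x - sym N y‖ = 2 := by
  have e : sym N x - sym N y = ((2 * (((x N).val : ℝ) - (y N).val) : ℝ) : ℂ) := by
    simp only [sym, coord, ContinuousMap.sub_apply, ContinuousMap.smul_apply,
      ContinuousMap.coe_mk, ContinuousMap.one_apply, smul_eq_mul]
    push_cast
    ring
  rw [e, Complex.norm_real, Real.norm_eq_abs, abs_mul, abs_val_sub_val, if_neg h]
  norm_num

lemma two_mul_delta_le_diracDist {γ : ℝ} (hγ : γ ∈ Set.Ioo (0 : ℝ) 1) (x y : CantorGroup) :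
    2 * delta γ x y ≤ diracDist γ x y := by
  obtain rfl | hxy := eq_or_ne x y
  · rw [delta_self, mul_zero]
    exact ENNReal.toReal_nonneg
  refine (mul_le_mul_of_nonneg_left (delta_le hγ x y) zero_le_two).trans ?_
  refine (ENNReal.ofReal_le_iff_le_toReal (diracEDist_ne_top hγ x y)).1 ?_
  -- The test function is the scaled symmetry at the first differing coordinate.
  refine le_trans (le_of_eq ?_)
    (le_iSup₂_of_le _ (commutatorNormLE_pow_smul_sym hγ (m x y - 1)) le_rfl)
  rw [← ofReal_norm]
  congr 1
  simp only [ContinuousMap.evalCLM_apply, ContinuousMap.smul_apply]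
  rw [← smul_sub, norm_smul, norm_sym_apply_sub_apply (apply_m_ne hxy), Complex.norm_real,
    Real.norm_of_nonneg (pow_nonneg hγ.1.le _), mul_comm]

/-! ### Inequivalence for different parameters -/

lemma delta_single (γ : ℝ) (n : ℕ) :
    delta γ (Pi.single n 1) 0 = γ ^ n * (1 - γ) := by
  rw [delta_eq, tsum_eq_single n]
  · simp
  · intro k hk
    simp [hk]

lemma not_forall_mul_pow_le {r s c C : ℝ} (hs : 0 < s) (hsr : s < r) (hc : 0 < c) :
    ¬ ∀ n : ℕ, c * r ^ n ≤ C * s ^ n := by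
  intro h
  obtain ⟨n, hn⟩ := pow_unbounded_of_one_lt (C / c) ((one_lt_div hs).2 hsr)
  have h' := h n
  rw [div_pow, div_lt_div_iff₀ hc (pow_pos hs n)] at hn
  linarith

lemma not_equivalentMetrics_delta {γ₁ γ₂ : ℝ} (h₁ : γ₁ ∈ Set.Ioo (0 : ℝ) 1)
    (h₂ : γ₂ ∈ Set.Ioo (0 : ℝ) 1) (hne : γ₁ ≠ γ₂) :
    ¬ EquivalentMetrics (delta γ₁) (delta γ₂) := by
  rintro ⟨-, k, K, hk, hK, h⟩
  have h' := fun n : ℕ => h (Pi.single n 1) 0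
  simp only [id, delta_single] at h'
  have e₁ : 0 < 1 - γ₁ := by linarith [h₁.2]
  have e₂ : 0 < 1 - γ₂ := by linarith [h₂.2]
  -- The constant `K` fails if `γ₁ < γ₂`, and `k` fails if `γ₂ < γ₁`.
  rcases lt_or_gt_of_ne hne with hlt | hlt
  · exact not_forall_mul_pow_le (C := K * (1 - γ₁)) h₁.1 hlt e₂ fun n => by linarith [(h' n).2]
  · exact not_forall_mul_pow_le (C := 1 - γ₂) h₂.1 hlt (mul_pos hk e₁) fun n => by
      linarith [(h' n).1]

/-- Each `d_γ` lies between constant multiples of `δ_γ`, so the bi-Lipschitz constants only get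
rescaled. -/
lemma equivalentMetrics_delta_of_diracDist {γ₁ γ₂ : ℝ} (h₁ : γ₁ ∈ Set.Ioo (0 : ℝ) 1)
    (h₂ : γ₂ ∈ Set.Ioo (0 : ℝ) 1) (h : EquivalentMetrics (diracDist γ₁) (diracDist γ₂)) :
    EquivalentMetrics (delta γ₁) (delta γ₂) := by
  obtain ⟨hb, k, K, hk, hK, h⟩ := h
  have e₁ : 0 < 2 / (1 - γ₁) ^ 3 := div_pos two_pos (pow_pos (by linarith [h₁.2]) 3)
  have e₂ : 0 < 2 / (1 - γ₂) ^ 3 := div_pos two_pos (pow_pos (by linarith [h₂.2]) 3)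
  refine ⟨hb, k * 2 / (2 / (1 - γ₂) ^ 3), K * (2 / (1 - γ₁) ^ 3) / 2, by positivity,
    by positivity, fun x y => ⟨?_, ?_⟩⟩
  · have h3 := (mul_le_mul_of_nonneg_left (two_mul_delta_le_diracDist h₁ x y) hk.le).trans
      ((h x y).1.trans (diracDist_le h₂ x y))
    rw [div_mul_eq_mul_div, div_le_iff₀ e₂]
    simp only [id] at h3 ⊢
    linarith
  · have h3 := (two_mul_delta_le_diracDist h₂ x y).trans
      ((h x y).2.trans (mul_le_mul_of_nonneg_left (diracDist_le h₁ x y) hK.le))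
    simp only [id] at h3 ⊢
    linarith

end CantorGroup

theorem mainTheorem10 :
    (∀ γ : ℝ, γ ∈ Set.Ioo (0 : ℝ) 1 →
      (∀ x y : CantorGroup, x ≠ y →
        γ ^ (CantorGroup.m x y - 1) * (1 - γ) ≤ CantorGroup.delta γ x y ∧
        CantorGroup.delta γ x y ≤ γ ^ (CantorGroup.m x y - 1)) ∧
      (∀ x y : CantorGroup,
        CantorGroup.diracEDist γ x y ≠ ⊤ ∧
        2 * CantorGroup.delta γ x y ≤ CantorGroup.diracDist γ x y ∧
        CantorGroup.diracDist γ x y ≤ 2 / (1 - γ) ^ 3 * CantorGroup.delta γ x y)) ∧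
    (∀ γ₁ γ₂ : ℝ, γ₁ ∈ Set.Ioo (0 : ℝ) 1 → γ₂ ∈ Set.Ioo (0 : ℝ) 1 → γ₁ ≠ γ₂ →
      ¬ EquivalentMetrics (CantorGroup.delta γ₁) (CantorGroup.delta γ₂) ∧
      ¬ EquivalentMetrics (CantorGroup.diracDist γ₁) (CantorGroup.diracDist γ₂)) := by
  refine ⟨fun γ hγ => ⟨fun x y hxy => ⟨CantorGroup.le_delta hγ hxy, CantorGroup.delta_le hγ x y⟩,
    fun x y => ⟨CantorGroup.diracEDist_ne_top hγ x y,
      CantorGroup.two_mul_delta_le_diracDist hγ x y, CantorGroup.diracDist_le hγ x y⟩⟩,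
    fun γ₁ γ₂ h₁ h₂ hne => ?_⟩
  have h := CantorGroup.not_equivalentMetrics_delta h₁ h₂ hne
  exact ⟨h, fun h' => h (CantorGroup.equivalentMetrics_delta_of_diracDist h₁ h₂ h')⟩
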